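/- A mixed graph $G$ is obtained from a finite simple graph (its underlying graph) by orienting some of its edges. Its Hermitian adjacency matrix $H=(h_{uv})$ has $h_{uv}=i$ if there is an oriented edge from $u$ to $v$, $h_{uv}=-i$ if there is an oriented edge from $v$ to $u$, $h_{uv}=1$ if $u$ and $v$ are joined by an unoriented edge, and $h_{uv}=0$ otherwise. The Hermitian quasi-Laplacian matrix of $G$ is $Q_H=D+H$, where $D$ is the diagonal matrix of the vertex degrees in the underlying graph. $G$ is called quapartite if its vertex set can be partitioned into four (possibly empty) sets $V_1,V_2,V_3,V_4$ such that every unoriented edge joins $V_1$ with $V_3$ or $V_2$ with $V_4$, and every oriented edge goes from $V_1$ to $V_2$, from $V_2$ to $V_3$, from $V_3$ to $V_4$, or from $V_4$ to $V_1$. Let $G$ be a quapartite mixed graph with vertices $v_1,\dots,v_n$, $n\ge 1$. Then all $n^2$ cofactors of the $n\times n$ matrix $Q_H$, that is, the numbers $(-1)^{j+k}\det Q_H(j\,|\,k)$, where $Q_H(j\,|\,k)$ is $Q_H$ with row $j$ and column $k$ deleted, have the same modulus, and this common modulus equals the number of spanning trees of the underlying graph of $G$. -/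

import Mathlib

/-- A mixed graph without loops or multiple edges on the vertex set `V`: a simple graph (the
underlying graph), some of whose edges have been oriented. `Arc u v` means that there is an
oriented edge from `u` to `v`; an edge has at most one orientation. -/
structure MixedGraph (V : Type*) where
  underlying : SimpleGraph V
  Arc : V → V → Prop
  adj_of_arc : ∀ u v, Arc u v → underlying.Adj u v
  arc_asymm : ∀ u v, Arc u v → ¬ Arc v u

namespace MixedGraph

/-- `u` and `v` are joined by an unoriented edge. -/
def Edge {V : Type*} (G : MixedGraph V) (u v : V) : Prop :=
  G.underlying.Adj u v ∧ ¬ G.Arc u v ∧ ¬ G.Arc v u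

/-- The vertex set is partitioned into four (possibly empty) classes `P 0`, `P 1`, `P 2`, `P 3`
such that every unoriented edge joins `P 0` and `P 2` or joins `P 1` and `P 3`, and every oriented
edge goes from `P 0` to `P 1`, from `P 1` to `P 2`, from `P 2` to `P 3`, or from `P 3` to `P 0`
(the indices are taken modulo 4). -/
def IsQuapartite {V : Type*} (G : MixedGraph V) : Prop :=
  ∃ P : ZMod 4 → Set V,
    (∀ v, ∃! k, v ∈ P k) ∧
    (∀ u v, G.Edge u v → ∃ k, u ∈ P k ∧ v ∈ P (k + 2)) ∧
    (∀ u v, G.Arc u v → ∃ k, u ∈ P k ∧ v ∈ P (k + 1))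

open Classical in
/-- The Hermitian adjacency matrix `H`. -/
noncomputable def hermitianAdj {V : Type*} (G : MixedGraph V) : Matrix V V ℂ :=
  Matrix.of fun u v =>
    if G.Arc u v then Complex.I
    else if G.Arc v u then -Complex.I
    else if G.Edge u v then 1
    else 0

open Classical in
/-- The diagonal matrix `D` of the vertex degrees in the underlying graph. -/
noncomputable def degreeMatrix {V : Type*} [Fintype V] (G : MixedGraph V) : Matrix V V ℂ :=
  Matrix.diagonal fun v => (G.underlying.degree v : ℂ)

/-- The Hermitian quasi-Laplacian matrix `Q_H = D + H`. -/
noncomputable def quasiLaplacian {V : Type*} [Fintype V] (G : MixedGraph V) : Matrix V V ℂ :=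
  G.degreeMatrix + G.hermitianAdj

end MixedGraph

/-- The number of spanning trees of a graph. A spanning tree is a subgraph on the whole vertex set
that is a tree. -/
noncomputable def SimpleGraph.numSpanningTrees {V : Type*} (G : SimpleGraph V) : ℕ :=
  Set.ncard {T : SimpleGraph V | T ≤ G ∧ T.IsTree}

/-- The cofactor of the `(i, j)` entry of a square matrix: `(-1) ^ (i + j)` times the determinant
of the matrix obtained by deleting row `i` and column `j`. -/
def Matrix.cofactorAt {R : Type*} [CommRing R] {n : ℕ}
    (M : Matrix (Fin (n + 1)) (Fin (n + 1)) R) (i j : Fin (n + 1)) : R :=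
  (-1) ^ ((i : ℕ) + (j : ℕ)) * (M.submatrix i.succAbove j.succAbove).det

/-!
The quasi-Laplacian of a quapartite mixed graph is unitarily diagonally similar to the ordinary
Laplacian `L` of the underlying graph: if `S` is the diagonal matrix with entry `I ^ k` at the
vertices of the class `P k`, then `Q_H = S * L * Sᴴ`. Adjugates of diagonal matrices are diagonal,
so passing from `L` to `Q_H` multiplies each cofactor by a number of modulus one, and the claim is
the matrix-tree theorem for `L`.

All cofactors of `L` agree, since the rows of `L` sum to zero and `L` is symmetric
(`SimpleGraph.adjugate_lapMatrix_const`). A diagonal cofactor is the determinant of `L` with the row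
of a vertex `r` replaced by the unit vector at `r`. Every other row `v` is the sum over the neighbours
`w` of `v` of the vectors `e_v - e_w`, so by multilinearity the determinant is a sum over functions
`f` that send each `v ≠ r` to a neighbour. The summand of `f` is `1` if iterating `f` leads from every
vertex to `r`, and `0` otherwise (`Matrix.det_parentMatrix`). The functions of the first kind are the
parent maps of the spanning trees rooted at `r`
(`SimpleGraph.ncard_isParentMap_eq_numSpanningTrees`).
-/

/-- The matrix of the functional digraph of `f` rooted at `r`: the row of `r` is the unit vector at
`r`, and the row of any other vertex `v` is `e_v - e_{f v}`. -/
def Matrix.parentMatrix {V : Type*} [DecidableEq V] (R : Type*) [Ring R] (r : V) (f : V → V) :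
    Matrix V V R :=
  Matrix.of fun v => if v = r then Pi.single r 1 else Pi.single v 1 - Pi.single (f v) 1

namespace SimpleGraph

variable {V : Type*}

/-- `f` sends each vertex other than the root `r` to a neighbour in `G`, its parent, in such a way
that the successive ancestors of every vertex end at `r`. The root is its own parent by
convention. -/
def IsParentMap (G : SimpleGraph V) (r : V) (f : V → V) : Prop :=
  f r = r ∧ (∀ v, v ≠ r → G.Adj v (f v)) ∧ ∀ v, ∃ k, f^[k] v = r

/-- The graph whose edges join `v` and `f v` for all `v` with `f v ≠ v`. -/
def parentGraph (f : V → V) : SimpleGraph V :=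
  SimpleGraph.fromRel fun v w => f v = w

end SimpleGraph

/-! ### Determinants of functional digraphs -/

namespace Matrix

variable {V R : Type*} [Fintype V] [DecidableEq V]

theorem parentMatrix_mulVec [Ring R] (r : V) (f : V → V) (x : V → R) (v : V) :
    (parentMatrix R r f *ᵥ x) v = if v = r then x r else x v - x (f v) := by
  by_cases h : v = r
  · simp [parentMatrix, mulVec, h]
  · rw [if_neg h, mulVec]
    have hrow : parentMatrix R r f v = Pi.single v 1 - Pi.single (f v) 1 := if_neg h
    rw [hrow, sub_dotProduct, single_one_dotProduct, single_one_dotProduct]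

theorem det_parentMatrix_eq_one [CommRing R] {r : V} {f : V → V}
    (hf : ∀ v, ∃ k, f^[k] v = r) : (parentMatrix R r f).det = 1 := by
  classical
  -- Ordering the vertices by decreasing distance to the root makes the matrix triangular.
  let d : V → ℕ := fun v => Nat.find (hf v)
  have hd : ∀ v, v ≠ r → d (f v) < d v := by
    intro v hv
    have h0 : d v ≠ 0 := by
      intro h
      have := Nat.find_spec (hf v)
      simp only [d] at h
      rw [h] at this
      exact hv this
    obtain ⟨m, hm⟩ := Nat.exists_eq_succ_of_ne_zero h0
    have hs : f^[d v] v = r := Nat.find_spec (hf v)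
    rw [hm, Function.iterate_succ_apply] at hs
    have : d (f v) ≤ m := Nat.find_min' (hf (f v)) hs
    omega
  have hfv : ∀ v, v ≠ r → f v ≠ v := fun v hv h => by
    have := hd v hv
    rw [h] at this
    exact lt_irrefl _ this
  have hentry : ∀ v w, v ≠ w → d v ≤ d w → parentMatrix R r f v w = 0 := by
    intro v w hvw hle
    by_cases h : v = r
    · simp only [parentMatrix, of_apply, if_pos h]
      rw [Pi.single_eq_of_ne]
      exact fun h' => hvw (h.trans h'.symm)
    · have : w ≠ f v := by
        rintro rfl
        exact absurd (hd v h) (not_lt.mpr hle)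
      simp [parentMatrix, h, hvw.symm, this]
  have htri : (parentMatrix R r f).BlockTriangular (fun v => OrderDual.toDual (d v)) := by
    intro v w hvw
    have hlt : d v < d w := hvw
    exact hentry v w (fun h => by simp [h] at hlt) hlt.le
  rw [htri.det]
  refine Finset.prod_eq_one fun a _ => ?_
  have hblock : (parentMatrix R r f).toSquareBlock (fun v => OrderDual.toDual (d v)) a = 1 := by
    ext ⟨v, hv⟩ ⟨w, hw⟩
    by_cases hvw : v = w
    · subst hvw
      by_cases h : v = r
      · simp [toSquareBlock_def, parentMatrix, h]
      · simp [toSquareBlock_def, parentMatrix, h, (hfv v h).symm]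
    · have hdeq : d v = d w := OrderDual.toDual.injective (hv.trans hw.symm)
      simp only [toSquareBlock_def, of_apply]
      rw [hentry v w hvw hdeq.le, one_apply_ne]
      simpa using hvw
  rw [hblock, det_one]

/-- The indicator of the set of vertices that never reach the root lies in the kernel. -/
theorem det_parentMatrix_eq_zero [CommRing R] [IsDomain R] {r : V} {f : V → V}
    (hf : ¬ ∀ v, ∃ k, f^[k] v = r) : (parentMatrix R r f).det = 0 := by
  classical
  rw [← exists_mulVec_eq_zero_iff]
  refine ⟨fun v => if ∃ k, f^[k] v = r then 0 else 1, ?_, ?_⟩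
  · push Not at hf
    obtain ⟨v, hv⟩ := hf
    intro h
    have := congrFun h v
    simp [hv] at this
  · ext v
    rw [parentMatrix_mulVec]
    by_cases h : v = r
    · rw [if_pos h, if_pos ⟨0, rfl⟩]; rfl
    · have : (∃ k, f^[k] v = r) ↔ ∃ k, f^[k] (f v) = r := by
        constructor
        · rintro ⟨_ | k, hk⟩
          · exact absurd hk h
          · exact ⟨k, hk⟩
        · rintro ⟨k, hk⟩
          exact ⟨k + 1, hk⟩
      simp [h, this]

open Classical in
theorem det_parentMatrix [CommRing R] [IsDomain R] (r : V) (f : V → V) :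
    (parentMatrix R r f).det = if ∀ v, ∃ k, f^[k] v = r then 1 else 0 := by
  split_ifs with h
  · exact det_parentMatrix_eq_one h
  · exact det_parentMatrix_eq_zero h

end Matrix

/-! ### Parent maps and spanning trees -/

namespace SimpleGraph

variable {V : Type*} {G : SimpleGraph V} {r : V} {f g : V → V}

theorem parentGraph_adj {v w : V} :
    (parentGraph f).Adj v w ↔ v ≠ w ∧ (f v = w ∨ f w = v) := Iff.rfl

theorem IsParentMap.ne (hf : G.IsParentMap r f) {v : V} (hv : v ≠ r) : v ≠ f v :=
  (hf.2.1 v hv).ne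

theorem IsParentMap.parentGraph_le (hf : G.IsParentMap r f) : parentGraph f ≤ G := by
  have key : ∀ v w, v ≠ w → f v = w → G.Adj v w := by
    rintro v _ hvw rfl
    exact hf.2.1 v fun h => hvw (by rw [h, hf.1])
  intro v w h
  rcases parentGraph_adj.1 h with ⟨hne, h | h⟩
  · exact key v w hne h
  · exact (key w v hne.symm h).symm

theorem IsParentMap.connected_parentGraph (hf : G.IsParentMap r f) :
    (parentGraph f).Connected := by
  have hstep : ∀ v, (parentGraph f).Reachable v (f v) := by
    intro v
    by_cases h : v = f v
    · rw [← h]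
    · exact Adj.reachable (parentGraph_adj.2 ⟨h, Or.inl rfl⟩)
  have hiter : ∀ k v, (parentGraph f).Reachable v (f^[k] v) := by
    intro k
    induction k with
    | zero => exact fun v => Reachable.refl v
    | succ k ih => exact fun v => (hstep v).trans (ih (f v))
  have hroot : ∀ v, (parentGraph f).Reachable v r := by
    intro v
    obtain ⟨k, hk⟩ := hf.2.2 v
    exact hk ▸ hiter k v
  exact (connected_iff_exists_forall_reachable _).2 ⟨r, fun v => (hroot v).symm⟩

/-- Each edge of `parentGraph f` is `s(v, f v)` for some non-root `v`, so there are at most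
`|V| - 1` edges. -/
theorem IsParentMap.isTree_parentGraph [Finite V] (hf : G.IsParentMap r f) :
    (parentGraph f).IsTree := by
  have := Fintype.ofFinite V
  classical
  rw [isTree_iff_connected_and_card]
  refine ⟨hf.connected_parentGraph, le_antisymm ?_
    hf.connected_parentGraph.card_vert_le_card_edgeSet_add_one⟩
  have hsub : (parentGraph f).edgeSet ⊆
      ((Finset.univ.erase r).image fun v => s(v, f v) : Finset (Sym2 V)) := by
    intro e he
    induction e using Sym2.ind with
    | _ v w =>
      have key : ∀ v w, v ≠ w → f v = w →
          s(v, w) ∈ ((Finset.univ.erase r).image fun v => s(v, f v) : Finset (Sym2 V)) := by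
        rintro v _ hvw rfl
        refine Finset.mem_image.2 ⟨v, Finset.mem_erase.2 ⟨?_, Finset.mem_univ v⟩, rfl⟩
        exact fun h => hvw (by rw [h, hf.1])
      rcases parentGraph_adj.1 he with ⟨hne, h | h⟩
      · exact key v w hne h
      · rw [Sym2.eq_swap]
        exact key w v hne.symm h
  have h1 : Nat.card (parentGraph f).edgeSet ≤ (Finset.univ.erase r).card := by
    rw [Nat.card_coe_set_eq]
    refine (Set.ncard_le_ncard hsub).trans ?_
    rw [Set.ncard_coe_finset]
    exact Finset.card_image_le
  have h2 := Finset.card_erase_add_one (Finset.mem_univ r)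
  rw [Finset.card_univ] at h2
  rw [Nat.card_eq_fintype_card (α := V)]
  omega

theorem IsParentMap.eq_of_parentGraph_eq (hf : G.IsParentMap r f) (hg : G.IsParentMap r g)
    (h : parentGraph f = parentGraph g) : f = g := by
  have cross : ∀ {f g : V → V}, G.IsParentMap r f → parentGraph f = parentGraph g →
      ∀ v, f v ≠ g v → v ≠ r → g (f v) = v := by
    intro f g hf h v hv hr
    have hadj : (parentGraph f).Adj v (f v) := parentGraph_adj.2 ⟨hf.ne hr, Or.inl rfl⟩
    rw [h] at hadj
    rcases (parentGraph_adj.1 hadj).2 with h' | h'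
    · exact absurd h'.symm hv
    · exact h'
  -- If `f` and `g` differ at `v`, they also differ at `f v`; but they agree at the root.
  have step : ∀ v, f v ≠ g v → f (f v) ≠ g (f v) := by
    intro v hv heq
    have hr : v ≠ r := by
      rintro rfl
      exact hv (hf.1.trans hg.1.symm)
    have hcyc : f (f v) = v := heq.trans (cross hf h v hv hr)
    have htwo : ∀ k, f^[k] v = v ∨ f^[k] v = f v := by
      intro k
      induction k with
      | zero => exact Or.inl rfl
      | succ k ih =>
        rw [Function.iterate_succ_apply']
        rcases ih with ih | ih <;> rw [ih]
        · exact Or.inr rfl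
        · exact Or.inl hcyc
    obtain ⟨k, hk⟩ := hf.2.2 v
    rcases htwo k with h' | h'
    · exact hr (h'.symm.trans hk)
    · have hfr : f v = r := h'.symm.trans hk
      rw [hfr, hf.1] at hcyc
      exact hr hcyc.symm
  by_contra hne
  obtain ⟨v, hv⟩ := Function.ne_iff.1 hne
  have hall : ∀ k, f (f^[k] v) ≠ g (f^[k] v) := by
    intro k
    induction k with
    | zero => exact hv
    | succ k ih =>
      rw [Function.iterate_succ_apply']
      exact step _ ih
  obtain ⟨k, hk⟩ := hf.2.2 v
  have := hall k
  rw [hk] at this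
  exact this (hf.1.trans hg.1.symm)

/-- In a connected graph, choosing for each non-root vertex a neighbour closer to the root gives a
parent map. -/
theorem Connected.exists_isParentMap (hG : G.Connected) (r : V) : ∃ f, G.IsParentMap r f := by
  classical
  have hex : ∀ v, v ≠ r → ∃ w, G.Adj v w ∧ G.dist w r < G.dist v r := by
    intro v hv
    obtain ⟨p, hp⟩ := hG.exists_walk_length_eq_dist v r
    cases p with
    | nil => exact absurd rfl hv
    | cons hadj q =>
      refine ⟨_, hadj, ?_⟩
      have := dist_le q
      rw [Walk.length_cons] at hp
      omega
  choose! p hadj hdist using hex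
  refine ⟨fun v => if v = r then r else p v, by simp, fun v hv => by simpa [hv] using hadj v hv, ?_⟩
  intro v
  induction hn : G.dist v r using Nat.strong_induction_on generalizing v with
  | _ n ih =>
    subst hn
    by_cases hv : v = r
    · exact ⟨0, hv⟩
    · obtain ⟨k, hk⟩ := ih _ (hdist v hv) (p v) rfl
      refine ⟨k + 1, ?_⟩
      rw [Function.iterate_succ_apply, if_neg hv]
      exact hk

/-- The spanning trees of `G` correspond to the parent maps of `G` with a given root. -/
theorem ncard_isParentMap_eq_numSpanningTrees [Finite V] (G : SimpleGraph V) (r : V) :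
    {f | G.IsParentMap r f}.ncard = G.numSpanningTrees := by
  refine Set.ncard_congr (fun f _ => parentGraph f) ?_ ?_ ?_
  · exact fun f hf => ⟨hf.parentGraph_le, hf.isTree_parentGraph⟩
  · exact fun f g hf hg h => hf.eq_of_parentGraph_eq hg h
  · rintro T ⟨hTG, hT⟩
    obtain ⟨f, hf⟩ := hT.connected.exists_isParentMap r
    refine ⟨f, ⟨hf.1, fun v hv => hTG (hf.2.1 v hv), hf.2.2⟩, ?_⟩
    exact ((isTree_iff_minimal_connected.1 hT).eq_of_ge hf.connected_parentGraph
      hf.parentGraph_le).symm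

/-! ### The matrix-tree theorem -/

variable {R : Type*} [Fintype V] [DecidableEq V] (G) [DecidableRel G.Adj]

theorem adjugate_lapMatrix_const [CommRing R] [IsDomain R] (i j k l : V) :
    (G.lapMatrix R).adjugate i j = (G.lapMatrix R).adjugate k l := by
  -- With a row replaced by `e_i - e_k`, all rows of the Laplacian still sum to zero.
  have hrow : ∀ i j k, (G.lapMatrix R).adjugate i j = (G.lapMatrix R).adjugate k j := by
    intro i j k
    have hzero : ((G.lapMatrix R).updateRow j (Pi.single i 1 - Pi.single k 1)).det = 0 := by
      rw [← Matrix.exists_mulVec_eq_zero_iff]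
      refine ⟨fun _ => 1, fun h => one_ne_zero (congrFun h j), ?_⟩
      ext v
      by_cases hv : v = j
      · subst hv
        rw [Matrix.mulVec, Matrix.updateRow_self, sub_dotProduct, single_one_dotProduct,
          single_one_dotProduct, sub_self, Pi.zero_apply]
      · have := congrFun (G.lapMatrix_mulVec_const_eq_zero (R := R)) v
        rw [Matrix.mulVec] at this ⊢
        rwa [Matrix.updateRow_ne hv]
    have hadd := Matrix.det_updateRow_add (G.lapMatrix R) j
      (Pi.single i 1 - Pi.single k 1) (Pi.single k 1)
    rw [sub_add_cancel, hzero, zero_add] at hadd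
    rw [Matrix.adjugate_apply, Matrix.adjugate_apply, hadd]
  have hsymm : ∀ i j, (G.lapMatrix R).adjugate i j = (G.lapMatrix R).adjugate j i :=
    fun i j => ((G.isSymm_lapMatrix (R := R)).adjugate.apply j i)
  rw [hrow i j l, hsymm, hrow j l k]

/-- The matrix-tree theorem. The determinant of the Laplacian with the row of `i` replaced by a unit
vector is expanded into the determinants of the matrices `Matrix.parentMatrix R i f`. -/
theorem adjugate_lapMatrix_eq_numSpanningTrees [CommRing R] [IsDomain R] (i j : V) :
    (G.lapMatrix R).adjugate i j = G.numSpanningTrees := by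
  classical
  rw [adjugate_lapMatrix_const G i j i i, Matrix.adjugate_apply]
  let A : V → Finset V := fun v => if v = i then {i} else G.neighborFinset v
  let e : V → V → V → R :=
    fun v w => if v = i then Pi.single i 1 else Pi.single v 1 - Pi.single w 1
  have hsum : (G.lapMatrix R).updateRow i (Pi.single i 1) = fun v => ∑ w ∈ A v, e v w := by
    ext v u
    by_cases hv : v = i
    · subst hv
      simp [A, e]
    · rw [Matrix.updateRow_ne hv]
      simp only [A, e, if_neg hv, Finset.sum_apply, Pi.sub_apply, Finset.sum_sub_distrib,
        Finset.sum_const, card_neighborFinset_eq_degree, Pi.single_apply,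
        Finset.sum_ite_eq, mem_neighborFinset]
      by_cases huv : u = v
      · subst huv
        simp [lapMatrix, degMatrix]
      · simp [lapMatrix, degMatrix, huv, Matrix.diagonal_apply_ne _ (Ne.symm huv)]
  have hexp : Matrix.det (fun v => ∑ w ∈ A v, e v w) =
      ∑ f ∈ Fintype.piFinset A, Matrix.det (fun v => e v (f v)) :=
    (Matrix.detRowAlternating (n := V) (R := R)).toMultilinearMap.map_sum_finset e A
  have hdet : ∀ f : V → V, Matrix.det (fun v => e v (f v)) =
      if ∀ v, ∃ k, f^[k] v = i then 1 else 0 := fun f => Matrix.det_parentMatrix i f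
  rw [hsum, hexp, Finset.sum_congr rfl fun f _ => hdet f, Finset.sum_boole,
    ← ncard_isParentMap_eq_numSpanningTrees G i, ← Set.ncard_coe_finset]
  congr 2
  ext f
  simp only [Finset.coe_filter, Fintype.mem_piFinset, Set.mem_ofPred_eq, IsParentMap, A]
  rw [← and_assoc]
  refine and_congr_left fun _ => ⟨fun h => ⟨by simpa using h i, fun v hv => ?_⟩, fun h v => ?_⟩
  · simpa [hv] using h v
  · by_cases hv : v = i
    · subst hv
      simpa using h.1
    · simpa [hv] using h.2 v hv

end SimpleGraph

/-! ### The quasi-Laplacian of a quapartite graph -/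

open Classical in
/-- Weighting the vertices of the class `P k` by `I ^ k` turns the Laplacian of the underlying graph
into the quasi-Laplacian. -/
theorem MixedGraph.IsQuapartite.exists_quasiLaplacian_eq {V : Type*} [Fintype V]
    {G : MixedGraph V} (hG : G.IsQuapartite) :
    ∃ s : V → ℂ, (∀ v, ‖s v‖ = 1) ∧ G.quasiLaplacian =
      Matrix.diagonal s * G.underlying.lapMatrix ℂ * Matrix.diagonal (star s) := by
  obtain ⟨P, hP, hE, hA⟩ := hG
  choose c hc huniq using hP
  have hclass : ∀ {v k}, v ∈ P k → c v = k := fun {v k} h => (huniq v k h).symm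
  have hnorm : ∀ k : ZMod 4, ‖Complex.I ^ k.val‖ = 1 := fun k => by simp
  have hself : ∀ k : ZMod 4, Complex.I ^ k.val * star (Complex.I ^ k.val) = 1 := fun k => by
    rw [Complex.star_def, Complex.mul_conj, Complex.normSq_eq_norm_sq, hnorm]
    simp
  have hadd : ∀ k l : ZMod 4, Complex.I ^ (k + l).val = Complex.I ^ k.val * Complex.I ^ l.val :=
    fun k l => by rw [ZMod.val_add, ← Complex.I_pow_eq_pow_mod, pow_add]
  have hshift : ∀ k l : ZMod 4,
      Complex.I ^ k.val * star (Complex.I ^ (k + l).val) = star (Complex.I ^ l.val) := fun k l => by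
    rw [hadd, star_mul', ← mul_assoc, hself, one_mul]
  have hshift' : ∀ k l : ZMod 4,
      Complex.I ^ (k + l).val * star (Complex.I ^ k.val) = Complex.I ^ l.val := fun k l => by
    rw [hadd, mul_right_comm, hself, one_mul]
  have hone : Complex.I ^ (1 : ZMod 4).val = Complex.I := pow_one _
  have htwo : Complex.I ^ (2 : ZMod 4).val = -1 := Complex.I_sq
  refine ⟨fun v => Complex.I ^ (c v).val, fun v => hnorm _, ?_⟩
  ext u v
  rw [Matrix.mul_diagonal, Matrix.diagonal_mul, mul_right_comm, Pi.star_apply]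
  simp only [MixedGraph.quasiLaplacian, MixedGraph.degreeMatrix, MixedGraph.hermitianAdj,
    SimpleGraph.lapMatrix, SimpleGraph.degMatrix, Matrix.add_apply, Matrix.sub_apply,
    Matrix.of_apply, SimpleGraph.adjMatrix_apply]
  by_cases huv : u = v
  · subst huv
    have hloop : ¬ G.underlying.Adj u u := G.underlying.loopless.irrefl u
    have harc : ¬ G.Arc u u := fun h => hloop (G.adj_of_arc u u h)
    rw [hself, one_mul]
    simp [harc, MixedGraph.Edge]
  simp only [Matrix.diagonal_apply_ne _ huv]
  by_cases h₁ : G.Arc u v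
  · obtain ⟨k, hu, hv⟩ := hA u v h₁
    rw [hclass hu, hclass hv, hshift, hone, if_pos h₁, if_pos (G.adj_of_arc u v h₁)]
    simp
  by_cases h₂ : G.Arc v u
  · obtain ⟨k, hv, hu⟩ := hA v u h₂
    rw [hclass hu, hclass hv, hshift', hone, if_neg h₁, if_pos h₂,
      if_pos (G.adj_of_arc v u h₂).symm]
    simp
  by_cases h₃ : G.underlying.Adj u v
  · obtain ⟨k, hu, hv⟩ := hE u v ⟨h₃, h₁, h₂⟩
    rw [hclass hu, hclass hv, hshift, htwo, if_neg h₁, if_neg h₂, if_pos ⟨h₃, h₁, h₂⟩, if_pos h₃]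
    simp
  · simp [h₁, h₂, h₃, MixedGraph.Edge]

theorem Matrix.cofactorAt_eq_adjugate {R : Type*} [CommRing R] {n : ℕ}
    (M : Matrix (Fin (n + 1)) (Fin (n + 1)) R) (i j : Fin (n + 1)) :
    M.cofactorAt i j = M.adjugate j i :=
  (M.adjugate_fin_succ_eq_det_submatrix j i).symm

theorem MixedGraph.IsQuapartite.norm_adjugate_quasiLaplacian {V : Type*} [Fintype V]
    [DecidableEq V] {G : MixedGraph V} (hG : G.IsQuapartite) (u v : V) :
    ‖G.quasiLaplacian.adjugate u v‖ = G.underlying.numSpanningTrees := by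
  classical
  obtain ⟨s, hs, hQ⟩ := hG.exists_quasiLaplacian_eq
  have hprod : ∀ t : Finset V, ‖∏ w ∈ t, s w‖ = 1 := fun t => by
    rw [norm_prod, Finset.prod_congr rfl fun w _ => hs w, Finset.prod_const_one]
  have hprod' : ∀ t : Finset V, ‖∏ w ∈ t, star (s w)‖ = 1 := fun t => by
    rw [← star_prod, norm_star, hprod]
  have hdec : (fun a b => Classical.propDecidable (a = b)) = ‹DecidableEq V› :=
    Subsingleton.elim _ _
  rw [hQ, hdec, Matrix.adjugate_mul_distrib, Matrix.adjugate_mul_distrib, Matrix.adjugate_diagonal,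
    Matrix.adjugate_diagonal, Matrix.diagonal_mul, Matrix.mul_diagonal, norm_mul, norm_mul,
    SimpleGraph.adjugate_lapMatrix_eq_numSpanningTrees]
  simp only [Pi.star_apply]
  rw [hprod, hprod', one_mul, mul_one, Complex.norm_natCast]

/-- `e` lists the vertices of `G`, so that `G.quasiLaplacian.submatrix e e` is the quasi-Laplacian
with rows and columns in that order. -/
theorem mainTheorem7 {V : Type*} [Fintype V] (G : MixedGraph V) (hG : G.IsQuapartite)
    {n : ℕ} (e : Fin (n + 1) ≃ V) :
    (∀ i j k l : Fin (n + 1),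
      ‖(G.quasiLaplacian.submatrix e e).cofactorAt i j‖ =
        ‖(G.quasiLaplacian.submatrix e e).cofactorAt k l‖) ∧
    (∀ i j : Fin (n + 1),
      ‖(G.quasiLaplacian.submatrix e e).cofactorAt i j‖ =
        (G.underlying.numSpanningTrees : ℝ)) := by
  classical
  have key : ∀ i j : Fin (n + 1),
      ‖(G.quasiLaplacian.submatrix e e).cofactorAt i j‖ =
        (G.underlying.numSpanningTrees : ℝ) := by
    intro i j
    rw [Matrix.cofactorAt_eq_adjugate, Matrix.adjugate_submatrix_equiv_self,
      Matrix.submatrix_apply, hG.norm_adjugate_quasiLaplacian]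
  exact ⟨fun i j k l => (key i j).trans (key k l).symm, key⟩
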